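/- Let $\mu>1$ and $z\in\mathbb R$. Let $\operatorname{arcsech}:(0,1]\to[0,\infty)$ be the inverse of $\operatorname{sech}=1/\cosh$ on $[0,\infty)$, and put $$x_1=z+\frac{1}{\sqrt{\mu-1}}\operatorname{arcsech}\sqrt{\frac{\mu+1}{2\mu}}.$$ There is exactly one $x_0\in\mathbb R$ with $$\tanh\frac{z-x_0}{\sqrt2}=\sqrt{\tfrac{2}{\mu+1}}\,\operatorname{sech}\big(\sqrt{\mu-1}\,(z-x_1)\big).$$ With this $x_0$ define $$u_0(x)=\begin{cases}\sqrt{\frac{2}{\mu+1}}\operatorname{sech}(\sqrt{\mu-1}(x-x_1)), & x\le z,\\ \tanh\frac{x-x_0}{\sqrt2}, & x>z,\end{cases}\qquad v_0(x)=\begin{cases}\sqrt{1-\frac{2\mu}{\mu+1}\operatorname{sech}^2(\sqrt{\mu-1}(x-x_1))}, & x\le z,\\ 0, & x>z.\end{cases}$$ Then: (i) $u_0\in C^2(\mathbb R)$, $v_0\in C(\mathbb R)$, and $(u_0,v_0)$ solves on $\mathbb R$ the system $$u''+u(1-u^2-\mu v^2)=0,\qquad v(1-v^2-\mu u^2)=0.$$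 (ii) $u_0$ is Lipschitz continuous on $\mathbb R$ and $v_0$ is Hölder continuous on $\mathbb R$ with exponent $\frac12$. (iii) Let $Y$ be the set of pairs $(u,v)\in H^1_{loc}(\mathbb R)\times C(\mathbb R)$ ($u$ being taken as its continuous representative) with $(u,v)\to(0,1)$ as $x\to-\infty$ and $(u,v)\to(1,0)$ as $x\to+\infty$, and let $$\tilde E(u,v)=\int_{-\infty}^{\infty}\frac{(u')^2}{2}+\frac14(u^2+v^2-1)^2+\frac{\mu-1}{2}u^2v^2\,dx\in[0,\infty].$$ Then $(u_0,v_0)\in Y$, $\tilde E(u_0,v_0)<\infty$, and $(u_0,v_0)$ minimizes $\tilde E$ over $Y$. Moreover it is the unique minimizer up to translation: $(u,v)\in Y$ minimizes $\tilde E$ over $Y$ if and only if there is $c\in\mathbb R$ with $u(x)=u_0(x-c)$ and $v(x)=v_0(x-c)$ for all $x\in\mathbb R$. -/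

import Mathlib

open MeasureTheory Filter Topology
open scoped ContDiff NNReal ENNReal

noncomputable section

namespace ThomasFermi

/-- `f ∈ L²_loc(ℝ)`. -/
def MemL2Loc (f : ℝ → ℝ) : Prop :=
  ∀ K : Set ℝ, IsCompact K → MemLp f 2 (volume.restrict K)

/-- `g` is a weak (distributional) derivative of `u` on `ℝ`; used for `u, g ∈ L²_loc(ℝ)`. -/
def HasWeakDeriv (u g : ℝ → ℝ) : Prop :=
  ∀ φ : ℝ → ℝ, ContDiff ℝ ∞ φ → HasCompactSupport φ →
    ∫ x, u x * deriv φ x = -∫ x, g x * φ x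

/-- `u ∈ H¹_loc(ℝ)`: both `u` and its weak derivative are locally square integrable. -/
def MemH1Loc (u : ℝ → ℝ) : Prop :=
  MemL2Loc u ∧ ∃ g : ℝ → ℝ, MemL2Loc g ∧ HasWeakDeriv u g

open Classical in
/-- The weak derivative of `u ∈ H¹_loc(ℝ)`, which is unique up to null sets. -/
def weakDeriv (u : ℝ → ℝ) : ℝ → ℝ :=
  if h : ∃ g : ℝ → ℝ, MemL2Loc g ∧ HasWeakDeriv u g then h.choose else 0

/-- The class `H¹_loc × C` with the conditions at infinity. As usual in dimension one, an element
of `H¹_loc(ℝ)` is identified with its continuous representative, so that its values and limits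
make sense. -/
structure Admissible (u v : ℝ → ℝ) : Prop where
  memH1Loc_u : MemH1Loc u
  continuous_u : Continuous u
  continuous_v : Continuous v
  u_atBot : Tendsto u atBot (𝓝 0)
  v_atBot : Tendsto v atBot (𝓝 1)
  u_atTop : Tendsto u atTop (𝓝 1)
  v_atTop : Tendsto v atTop (𝓝 0)

/-- The Thomas–Fermi energy, with values in `[0, ∞]`; its density is nonnegative for `μ ≥ 1`. -/
def energy (μ : ℝ) (u v : ℝ → ℝ) : ℝ≥0∞ :=
  ∫⁻ x, ENNReal.ofReal ((weakDeriv u x) ^ 2 / 2 + (u x ^ 2 + v x ^ 2 - 1) ^ 2 / 4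
    + (μ - 1) / 2 * (u x ^ 2 * v x ^ 2))

/-- `(u, v)` minimizes the Thomas–Fermi energy in the admissible class. -/
def IsMinimizer (μ : ℝ) (u v : ℝ → ℝ) : Prop :=
  Admissible u v ∧ ∀ u₁ v₁ : ℝ → ℝ, Admissible u₁ v₁ → energy μ u v ≤ energy μ u₁ v₁

/-- `(u, v)` is a classical solution of the system with `ε = 0`, on the whole line:
`u'' + u (1 - u² - μ v²) = 0` and `v (1 - v² - μ u²) = 0`, with `u` of class `C²` and `v`
continuous. -/
structure IsSolution (μ : ℝ) (u v : ℝ → ℝ) : Prop where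
  contDiff_u : ContDiff ℝ 2 u
  continuous_v : Continuous v
  eq_u : ∀ x, deriv (deriv u) x + u x * (1 - u x ^ 2 - μ * v x ^ 2) = 0
  eq_v : ∀ x, v x * (1 - v x ^ 2 - μ * u x ^ 2) = 0

/-- The hyperbolic secant. -/
def sech (x : ℝ) : ℝ := 1 / Real.cosh x

/-- The inverse `(0, 1] → [0, ∞)` of the hyperbolic secant. -/
def arcsech (y : ℝ) : ℝ := Real.arcosh (1 / y)

/-- The centre of the sech piece for the gluing point `z`. It lies to the right of `z`, which makes
the sech piece increasing on `(-∞, z]`. -/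
def x₁ (μ z : ℝ) : ℝ := z + 1 / √(μ - 1) * arcsech √((μ + 1) / (2 * μ))

/-- The equation for the centre `x₀` of the tanh piece: both pieces of `u₀` agree at `z`. -/
def IsMatching (μ z x₀ : ℝ) : Prop :=
  Real.tanh ((z - x₀) / √2) = √(2 / (μ + 1)) * sech (√(μ - 1) * (z - x₁ μ z))

/-- The first component of the explicit solution. -/
def u₀ (μ z x₀ : ℝ) (x : ℝ) : ℝ :=
  if x ≤ z then √(2 / (μ + 1)) * sech (√(μ - 1) * (x - x₁ μ z))
  else Real.tanh ((x - x₀) / √2)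

/-- The second component of the explicit solution. -/
def v₀ (μ z : ℝ) (x : ℝ) : ℝ :=
  if x ≤ z then √(1 - 2 * μ / (μ + 1) * sech (√(μ - 1) * (x - x₁ μ z)) ^ 2) else 0

end ThomasFermi

end

/-!
Minimizing the potential over `v` for fixed `u` gives `v² = max (1 - μ u²) 0`, and what remains is
`speed(u)² / 2`. Completing the square, as in the Modica–Mortola trick, the energy density is the
exact derivative `speed(u) u'` plus nonnegative terms. Hence every admissible pair has energy at
least `∫₀¹ speed`, with equality if and only if it solves the first-order system `u' = speed(u)`,
`v² = max (1 - μ u²) 0`.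

The explicit pair solves this system: the sech piece solves it where `μ u² ≤ 1`, the tanh piece
where `μ u² ≥ 1`, and the two meet at `z` with the common value `1 / √μ`. Differentiating the
equation for `u` gives the second-order system. Conversely, any minimizer solves the first-order
system. Since `speed` is Lipschitz on `[0, 1]`, its component `u` is determined up to translation by
the limits at infinity; `v` cannot change sign because `{v ≠ 0} = {μ u² < 1}` is an interval, so
that `v = √(max (1 - μ u²) 0)`.
-/

noncomputable section

namespace ThomasFermi

section AbsolutelyContinuous

theorem intervalIntegrable_of_locallyIntegrable {E : Type*} [NormedAddCommGroup E] {f : ℝ → E}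
    (hf : LocallyIntegrable f) (a b : ℝ) : IntervalIntegrable f volume a b :=
  intervalIntegrable_iff.mpr <|
    (hf.integrableOn_isCompact isCompact_uIcc).mono_set Set.uIoc_subset_uIcc

theorem absolutelyContinuousOnInterval_comp_of_lipschitzOnWith {X Y : Type*}
    [PseudoMetricSpace X] [PseudoMetricSpace Y] {H : X → Y} {u : ℝ → X} {K : ℝ≥0} {a b : ℝ}
    (hH : LipschitzOnWith K H (u '' Set.uIcc a b)) (hu : AbsolutelyContinuousOnInterval u a b) :
    AbsolutelyContinuousOnInterval (H ∘ u) a b := by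
  have hKu := Tendsto.const_mul (K : ℝ) hu
  rw [mul_zero] at hKu
  refine squeeze_zero' (.of_forall fun _ => Finset.sum_nonneg fun _ _ => dist_nonneg) ?_ hKu
  filter_upwards [mem_inf_of_right (mem_principal_self _)] with I hI
  rw [Finset.mul_sum]
  refine Finset.sum_le_sum fun i hi => ?_
  obtain ⟨h₁, h₂⟩ := hI.1 i hi
  exact hH.dist_le_mul _ (Set.mem_image_of_mem u h₁) _ (Set.mem_image_of_mem u h₂)

variable {u g s : ℝ → ℝ}

theorem absolutelyContinuousOnInterval_of_sub_eq_integral (hg : LocallyIntegrable g)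
    (hu : ∀ x y, u y - u x = ∫ t in x..y, g t) (a b : ℝ) :
    AbsolutelyContinuousOnInterval u a b := by
  have hu' : u = fun x => u a + ∫ t in a..x, g t := by ext x; rw [← hu]; ring
  rw [hu']
  exact (LipschitzWith.const (u a)).lipschitzOnWith.absolutelyContinuousOnInterval.add <|
    (intervalIntegrable_of_locallyIntegrable hg a b
      ).absolutelyContinuousOnInterval_intervalIntegral Set.left_mem_uIcc

theorem ae_hasDerivAt_of_sub_eq_integral (hg : LocallyIntegrable g)
    (hu : ∀ x y, u y - u x = ∫ t in x..y, g t) : ∀ᵐ x, HasDerivAt u (g x) x := by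
  have hu' : u = fun x => u 0 + ∫ t in (0 : ℝ)..x, g t := by ext x; rw [← hu]; ring
  filter_upwards [_root_.LocallyIntegrable.ae_hasDerivAt_integral hg] with x hx
  rw [hu']
  exact (hx 0).const_add (u 0)

/- A primitive of `s` is `C¹`, hence Lipschitz on the compact interval `u([a, b])`, so that its
composition with `u` is again absolutely continuous. -/
theorem integral_comp_mul_eq_integral (hs : Continuous s) (hg : LocallyIntegrable g)
    (hu : ∀ x y, u y - u x = ∫ t in x..y, g t) (a b : ℝ) :
    ∫ x in a..b, s (u x) * g x = ∫ y in u a..u b, s y := by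
  set H : ℝ → ℝ := fun y => ∫ t in u a..y, s t
  have hH y : HasDerivAt H (s y) y := (hs.integral_hasStrictDerivAt (u a) y).hasDerivAt
  have hac := absolutelyContinuousOnInterval_of_sub_eq_integral hg hu a b
  have hHC1 : ContDiff ℝ 1 H :=
    contDiff_one_iff_deriv.2 ⟨fun y => (hH y).differentiableAt, (funext fun y => (hH y).deriv) ▸ hs⟩
  obtain ⟨K, hK⟩ : ∃ K, LipschitzOnWith K H (u '' Set.uIcc a b) :=
    LocallyLipschitzOn.exists_lipschitzOnWith_of_compact
      (isCompact_uIcc.image_of_continuousOn hac.continuousOn)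
      hHC1.locallyLipschitz.locallyLipschitzOn
  calc ∫ x in a..b, s (u x) * g x = ∫ x in a..b, deriv (H ∘ u) x := by
        refine intervalIntegral.integral_congr_ae ?_
        filter_upwards [ae_hasDerivAt_of_sub_eq_integral hg hu] with x hx _
        exact ((hH (u x)).comp x hx).deriv.symm
    _ = H (u b) - H (u a) :=
        (absolutelyContinuousOnInterval_comp_of_lipschitzOnWith hK hac).integral_deriv_eq_sub
    _ = ∫ y in u a..u b, s y := by simp only [H, intervalIntegral.integral_same, sub_zero]

end AbsolutelyContinuous

section TestFunctions

theorem exists_tsupport_subset_Ioo {E : Type*} [Zero E] {φ : ℝ → E} (hφ : HasCompactSupport φ) :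
    ∃ a b : ℝ, a < b ∧ tsupport φ ⊆ Set.Ioo a b := by
  obtain ⟨R, hR, h⟩ := hφ.isCompact.isBounded.subset_ball_lt 0 0
  exact ⟨-R, R, by linarith, by simpa [Real.ball_eq_Ioo] using h⟩

variable {E : Type*} [NormedAddCommGroup E] [NormedSpace ℝ E]

theorem hasCompactSupport_integral_of_integral_eq_zero {ψ : ℝ → E} {a b : ℝ}
    (hab : Function.support ψ ⊆ Set.Ioo a b) (h0 : ∫ x, ψ x = 0) :
    HasCompactSupport fun x => ∫ t in a..x, ψ t := by
  refine HasCompactSupport.intro (isCompact_Icc (a := a) (b := b)) fun x hx => ?_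
  rcases lt_or_ge x a with hxa | hax
  · refine intervalIntegral.integral_zero_ae (.of_forall fun t ht => ?_)
    rw [Set.uIoc_of_ge hxa.le] at ht
    exact Function.notMem_support.1 fun h => ht.2.not_gt (hab h).1
  · have hbx : b < x := not_le.1 fun h => hx ⟨hax, h⟩
    rw [intervalIntegral.integral_eq_integral_of_support_subset, h0]
    exact hab.trans fun t ht => ⟨ht.1, (ht.2.trans hbx).le⟩

variable [CompleteSpace E]

theorem exists_deriv_eq_of_integral_eq_zero {ψ : ℝ → E} (hψ : ContDiff ℝ ∞ ψ)
    (hψc : HasCompactSupport ψ) (h0 : ∫ x, ψ x = 0) :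
    ∃ φ : ℝ → E, ContDiff ℝ ∞ φ ∧ HasCompactSupport φ ∧ deriv φ = ψ := by
  obtain ⟨a, b, -, hab⟩ := exists_tsupport_subset_Ioo hψc
  have hd x : HasDerivAt (fun x => ∫ t in a..x, ψ t) (ψ x) x :=
    (hψ.continuous.integral_hasStrictDerivAt a x).hasDerivAt
  have hderiv : deriv (fun x => ∫ t in a..x, ψ t) = ψ := funext fun x => (hd x).deriv
  refine ⟨fun x => ∫ t in a..x, ψ t, ?_,
    hasCompactSupport_integral_of_integral_eq_zero ((subset_tsupport ψ).trans hab) h0, hderiv⟩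
  rw [contDiff_infty_iff_deriv, hderiv]
  exact ⟨fun x => (hd x).differentiableAt, hψ⟩

/- Du Bois-Reymond: every test function differs from a multiple of a fixed bump function by the
derivative of a test function, so integration against `w` is a multiple of integration. -/
theorem ae_eq_const_of_integral_deriv_smul_eq_zero {w : ℝ → E} (hw : LocallyIntegrable w)
    (h : ∀ φ : ℝ → ℝ, ContDiff ℝ ∞ φ → HasCompactSupport φ → ∫ x, deriv φ x • w x = 0) :
    ∃ c, w =ᵐ[volume] fun _ => c := by
  let B : ContDiffBump (0 : ℝ) := default
  set ρ : ℝ → ℝ := B.normed volume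
  have hρ : ContDiff ℝ ∞ ρ := B.contDiff_normed
  have hρc : HasCompactSupport ρ := B.hasCompactSupport_normed
  have hint {ψ : ℝ → ℝ} (hψ : ContDiff ℝ ∞ ψ) (hψc : HasCompactSupport ψ) : Integrable ψ :=
    hψ.continuous.integrable_of_hasCompactSupport hψc
  have hintw {ψ : ℝ → ℝ} (hψ : ContDiff ℝ ∞ ψ) (hψc : HasCompactSupport ψ) :
      Integrable fun x => ψ x • w x :=
    hw.integrable_smul_left_of_hasCompactSupport hψ.continuous hψc
  set c := ∫ x, ρ x • w x
  refine ⟨c, ?_⟩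
  suffices hae : ∀ᵐ x, w x - c = 0 from hae.mono fun x hx => sub_eq_zero.1 hx
  refine ae_eq_zero_of_integral_contDiff_smul_eq_zero (hw.sub (locallyIntegrable_const c)) ?_
  intro ψ hψ hψc
  set m := ∫ x, ψ x
  have hzero : ∫ x, (ψ x - m * ρ x) = 0 := by
    rw [integral_sub (hint hψ hψc) ((hint hρ hρc).const_mul m), integral_const_mul,
      B.integral_normed, mul_one, sub_self]
  obtain ⟨φ, hφ, hφc, hφd⟩ := exists_deriv_eq_of_integral_eq_zero
    (hψ.sub (contDiff_const.mul hρ)) (hψc.sub hρc.mul_left) hzero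
  have hψw : ∫ x, ψ x • w x = m • c := by
    have hφw := h φ hφ hφc
    simp only [hφd, sub_smul, mul_smul] at hφw
    rwa [integral_sub (hintw hψ hψc) ((hintw hρ hρc).fun_smul m), integral_smul, sub_eq_zero]
      at hφw
  simp only [smul_sub]
  rw [integral_sub (hintw hψ hψc) ((hint hψ hψc).smul_const c), integral_smul_const, hψw, sub_self]

end TestFunctions

section WeakDerivative

variable {u g : ℝ → ℝ}

theorem MemL2Loc.locallyIntegrable {f : ℝ → ℝ} (hf : MemL2Loc f) : LocallyIntegrable f := by
  refine locallyIntegrable_iff.2 fun K hK => ?_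
  have : IsFiniteMeasure (volume.restrict K) := ⟨by simpa using hK.measure_lt_top⟩
  exact (hf K hK).integrable one_le_two

theorem MemL2Loc.locallyIntegrable_sq {f : ℝ → ℝ} (hf : MemL2Loc f) :
    LocallyIntegrable fun x => f x ^ 2 :=
  locallyIntegrable_iff.2 fun K hK => (hf K hK).integrable_sq

theorem memL2Loc_of_continuous {f : ℝ → ℝ} (hf : Continuous f) : MemL2Loc f := by
  intro K hK
  have : IsFiniteMeasure (volume.restrict K) := ⟨by simpa using hK.measure_lt_top⟩
  obtain ⟨C, hC⟩ := hK.exists_bound_of_continuousOn hf.continuousOn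
  exact .of_bound hf.aestronglyMeasurable C
    ((ae_restrict_iff' hK.measurableSet).2 (.of_forall hC))

theorem hasWeakDeriv_primitive (hg : LocallyIntegrable g) (c : ℝ) :
    HasWeakDeriv (fun x => ∫ t in c..x, g t) g := by
  intro φ hφ hφc
  obtain ⟨a, b, -, hab⟩ := exists_tsupport_subset_Ioo hφc
  set F : ℝ → ℝ := fun x => ∫ t in c..x, g t
  have hF x y : F y - F x = ∫ t in x..y, g t :=
    intervalIntegral.integral_interval_sub_left (intervalIntegrable_of_locallyIntegrable hg _ _)
      (intervalIntegrable_of_locallyIntegrable hg _ _)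
  have hφ0 {x : ℝ} (hx : x ∉ Set.Ioo a b) : φ x = 0 :=
    image_eq_zero_of_notMem_tsupport fun h => hx (hab h)
  have htsupp : tsupport φ ⊆ Set.Ioc a b := hab.trans Set.Ioo_subset_Ioc_self
  calc ∫ x, F x * deriv φ x = ∫ x in a..b, F x * deriv φ x :=
        (intervalIntegral.integral_eq_integral_of_support_subset <|
          (Function.support_mul_subset_right _ _).trans <| support_deriv_subset.trans htsupp).symm
    _ = -∫ x in a..b, deriv F x * φ x := by
        rw [(absolutelyContinuousOnInterval_of_sub_eq_integral hg hF a b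
          ).integral_mul_deriv_eq_deriv_mul
            (hφ.of_le (by simp)).contDiffOn.absolutelyContinuousOnInterval,
          hφ0 Set.left_notMem_Ioo, hφ0 Set.right_notMem_Ioo]
        ring
    _ = -∫ x in a..b, g x * φ x := by
        refine congrArg Neg.neg (intervalIntegral.integral_congr_ae ?_)
        filter_upwards [ae_hasDerivAt_of_sub_eq_integral hg hF] with x hx _
        rw [hx.deriv]
    _ = -∫ x, g x * φ x := by
        rw [intervalIntegral.integral_eq_integral_of_support_subset <|
          (Function.support_mul_subset_right _ _).trans <| (subset_tsupport φ).trans htsupp]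

theorem HasWeakDeriv.sub {u₁ u₂ g₁ g₂ : ℝ → ℝ} (hu₁ : LocallyIntegrable u₁)
    (hu₂ : LocallyIntegrable u₂) (hg₁ : LocallyIntegrable g₁) (hg₂ : LocallyIntegrable g₂)
    (h₁ : HasWeakDeriv u₁ g₁) (h₂ : HasWeakDeriv u₂ g₂) :
    HasWeakDeriv (fun x => u₁ x - u₂ x) (fun x => g₁ x - g₂ x) := by
  intro φ hφ hφc
  have hint {f ψ : ℝ → ℝ} (hf : LocallyIntegrable f) (hψ : Continuous ψ)
      (hψc : HasCompactSupport ψ) : Integrable fun x => f x * ψ x :=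
    hf.integrable_smul_right_of_hasCompactSupport hψ hψc
  have hφ' : Continuous (deriv φ) := hφ.continuous_deriv (by simp)
  simp only [sub_mul]
  rw [integral_sub (hint hu₁ hφ' hφc.deriv) (hint hu₂ hφ' hφc.deriv),
    integral_sub (hint hg₁ hφ.continuous hφc) (hint hg₂ hφ.continuous hφc), h₁ φ hφ hφc,
    h₂ φ hφ hφc]
  ring

theorem HasWeakDeriv.ae_eq {g₁ g₂ : ℝ → ℝ} (hg₁ : LocallyIntegrable g₁)
    (hg₂ : LocallyIntegrable g₂) (h₁ : HasWeakDeriv u g₁) (h₂ : HasWeakDeriv u g₂) :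
    g₁ =ᵐ[volume] g₂ := by
  refine ae_eq_of_integral_contDiff_smul_eq hg₁ hg₂ fun φ hφ hφc => ?_
  simp only [smul_eq_mul, mul_comm (φ _)]
  exact neg_injective ((h₁ φ hφ hφc).symm.trans (h₂ φ hφ hφc))

theorem HasWeakDeriv.exists_eq_const (hu : Continuous u) (h : HasWeakDeriv u 0) :
    ∃ c, ∀ x, u x = c := by
  obtain ⟨c, hc⟩ := ae_eq_const_of_integral_deriv_smul_eq_zero hu.locallyIntegrable
    fun φ hφ hφc => by simpa [mul_comm] using h φ hφ hφc
  exact ⟨c, congrFun ((hu.ae_eq_iff_eq volume continuous_const).1 hc)⟩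

theorem HasWeakDeriv.sub_eq_integral (hu : Continuous u) (hg : LocallyIntegrable g)
    (h : HasWeakDeriv u g) (a b : ℝ) : u b - u a = ∫ x in a..b, g x := by
  have hgi := intervalIntegrable_of_locallyIntegrable hg
  have hF : Continuous fun x => ∫ t in (0 : ℝ)..x, g t :=
    intervalIntegral.continuous_primitive hgi 0
  have hdiff := h.sub hu.locallyIntegrable hF.locallyIntegrable hg hg (hasWeakDeriv_primitive hg 0)
  simp only [sub_self] at hdiff
  obtain ⟨c, hc⟩ := HasWeakDeriv.exists_eq_const (hu.sub hF) hdiff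
  rw [← intervalIntegral.integral_interval_sub_left (hgi 0 b) (hgi 0 a)]
  simp only [Pi.sub_apply] at hc
  linarith [hc a, hc b]

theorem hasWeakDeriv_of_hasDerivAt (hg : Continuous g) (h : ∀ x, HasDerivAt u (g x) x) :
    HasWeakDeriv u g := by
  intro φ hφ hφc
  have hu : Continuous u := continuous_iff_continuousAt.2 fun x => (h x).continuousAt
  have hφ' : Continuous (deriv φ) := hφ.continuous_deriv (by simp)
  exact integral_mul_deriv_eq_deriv_mul_of_integrable (fun x _ => h x)
    (fun x _ => (hφ.differentiable (by simp) x).hasDerivAt)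
    ((hu.mul hφ').integrable_of_hasCompactSupport hφc.deriv.mul_left)
    ((hg.mul hφ.continuous).integrable_of_hasCompactSupport hφc.mul_left)
    ((hu.mul hφ.continuous).integrable_of_hasCompactSupport hφc.mul_left)

theorem MemH1Loc.memL2Loc_weakDeriv (hu : MemH1Loc u) : MemL2Loc (weakDeriv u) := by
  rw [weakDeriv, dif_pos hu.2]
  exact hu.2.choose_spec.1

theorem MemH1Loc.hasWeakDeriv (hu : MemH1Loc u) : HasWeakDeriv u (weakDeriv u) := by
  rw [weakDeriv, dif_pos hu.2]
  exact hu.2.choose_spec.2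

theorem MemH1Loc.sub_eq_integral (hu : MemH1Loc u) (huc : Continuous u) (a b : ℝ) :
    u b - u a = ∫ x in a..b, weakDeriv u x :=
  hu.hasWeakDeriv.sub_eq_integral huc hu.memL2Loc_weakDeriv.locallyIntegrable a b

theorem memH1Loc_of_hasDerivAt (hg : Continuous g) (h : ∀ x, HasDerivAt u (g x) x) : MemH1Loc u :=
  ⟨memL2Loc_of_continuous (continuous_iff_continuousAt.2 fun x => (h x).continuousAt),
    g, memL2Loc_of_continuous hg, hasWeakDeriv_of_hasDerivAt hg h⟩

theorem weakDeriv_ae_eq_of_hasDerivAt (hg : Continuous g) (h : ∀ x, HasDerivAt u (g x) x) :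
    weakDeriv u =ᵐ[volume] g :=
  have hu := memH1Loc_of_hasDerivAt hg h
  hu.hasWeakDeriv.ae_eq hu.memL2Loc_weakDeriv.locallyIntegrable hg.locallyIntegrable
    (hasWeakDeriv_of_hasDerivAt hg h)

end WeakDerivative

section CompletingTheSquare

theorem lintegral_ofReal_add_eq_of_tendsto_integral {f e : ℝ → ℝ} {c : ℝ}
    (hf : LocallyIntegrable f) (he : LocallyIntegrable e) (he0 : ∀ x, 0 ≤ e x)
    (hfe : ∀ x, 0 ≤ f x + e x) (hc : 0 < c)
    (hlim : Tendsto (fun R => ∫ x in -R..R, f x) atTop (𝓝 c)) :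
    ∫⁻ x, ENNReal.ofReal (f x + e x) = ENNReal.ofReal c + ∫⁻ x, ENNReal.ofReal (e x) := by
  have hcover : AECover volume atTop fun R : ℝ => Set.Ioc (-R) R :=
    aecover_Ioc tendsto_neg_atTop_atBot tendsto_id
  refine hcover.lintegral_eq_of_tendsto _
    (hf.add he).aestronglyMeasurable.aemeasurable.ennreal_ofReal <| Tendsto.congr' ?_ <|
    (ENNReal.tendsto_ofReal hlim).add <| hcover.lintegral_tendsto_of_countably_generated
      he.aestronglyMeasurable.aemeasurable.ennreal_ofReal
  filter_upwards [hlim.eventually_const_lt hc, eventually_ge_atTop 0] with R hpos hR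
  have hle : -R ≤ R := by linarith
  have hfR := intervalIntegrable_of_locallyIntegrable hf (-R) R
  have heR := intervalIntegrable_of_locallyIntegrable he (-R) R
  have hofReal {h : ℝ → ℝ} (hh : IntervalIntegrable h volume (-R) R) (h0 : ∀ x, 0 ≤ h x) :
      ∫⁻ x in Set.Ioc (-R) R, ENNReal.ofReal (h x) = ENNReal.ofReal (∫ x in -R..R, h x) := by
    rw [intervalIntegral.integral_of_le hle]
    exact (ofReal_integral_eq_lintegral_ofReal
      ((intervalIntegrable_iff_integrableOn_Ioc_of_le hle).1 hh) (.of_forall h0)).symm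
  rw [hofReal heR he0, hofReal (hfR.add heR) hfe, intervalIntegral.integral_add hfR heR,
    ENNReal.ofReal_add hpos.le (intervalIntegral.integral_nonneg hle fun x _ => he0 x)]

/-- What remains of the density `u' ^ 2 / 2 + P` after subtracting the exact derivative `s(u) u'`,
as a sum of two terms that are nonnegative when `s(u) ^ 2 / 2 ≤ P`. -/
def excess (s P u : ℝ → ℝ) (x : ℝ) : ℝ :=
  (weakDeriv u x - s (u x)) ^ 2 / 2 + (P x - s (u x) ^ 2 / 2)

variable {u s P : ℝ → ℝ} {a b : ℝ}

theorem excess_nonneg {x : ℝ} (h : s (u x) ^ 2 / 2 ≤ P x) : 0 ≤ excess s P u x :=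
  add_nonneg (by positivity) (sub_nonneg.2 h)

theorem excess_eq_zero_iff {x : ℝ} (h : s (u x) ^ 2 / 2 ≤ P x) :
    excess s P u x = 0 ↔ weakDeriv u x = s (u x) ∧ P x = s (u x) ^ 2 / 2 := by
  rw [excess, add_eq_zero_iff_of_nonneg (by positivity) (sub_nonneg.2 h), div_eq_zero_iff,
    or_iff_left two_ne_zero, sq_eq_zero_iff, sub_eq_zero, sub_eq_zero]

theorem tendsto_integral_comp_mul_weakDeriv (hu : MemH1Loc u) (huc : Continuous u)
    (hs : Continuous s) (ha : Tendsto u atBot (𝓝 a)) (hb : Tendsto u atTop (𝓝 b)) :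
    Tendsto (fun R => ∫ x in -R..R, s (u x) * weakDeriv u x) atTop (𝓝 (∫ y in a..b, s y)) := by
  have hF : Continuous fun y => ∫ t in (0 : ℝ)..y, s t :=
    intervalIntegral.continuous_primitive hs.intervalIntegrable 0
  have hsub (x y : ℝ) : (∫ t in (0 : ℝ)..y, s t) - ∫ t in (0 : ℝ)..x, s t = ∫ t in x..y, s t :=
    intervalIntegral.integral_interval_sub_left (hs.intervalIntegrable _ _)
      (hs.intervalIntegrable _ _)
  have hlim := ((hF.tendsto b).comp hb).sub
    ((hF.tendsto a).comp (ha.comp tendsto_neg_atTop_atBot))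
  rw [hsub] at hlim
  refine hlim.congr fun R => ?_
  rw [integral_comp_mul_eq_integral hs hu.memL2Loc_weakDeriv.locallyIntegrable
    (hu.sub_eq_integral huc)]
  exact hsub _ _

theorem locallyIntegrable_comp_mul_weakDeriv (hu : MemH1Loc u) (huc : Continuous u)
    (hs : Continuous s) : LocallyIntegrable fun x => s (u x) * weakDeriv u x :=
  locallyIntegrable_iff.2 fun _ hK =>
    (hu.memL2Loc_weakDeriv.locallyIntegrable.integrableOn_isCompact hK).continuousOn_mul
      (hs.comp huc).continuousOn hK

theorem locallyIntegrable_excess (hu : MemH1Loc u) (huc : Continuous u) (hs : Continuous s)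
    (hP : Continuous P) : LocallyIntegrable (excess s P u) := by
  have hexpand : excess s P u = fun x =>
      (2⁻¹ : ℝ) • weakDeriv u x ^ 2 - s (u x) * weakDeriv u x + P x := by
    ext x
    simp only [excess, smul_eq_mul]
    ring
  rw [hexpand]
  exact ((hu.memL2Loc_weakDeriv.locallyIntegrable_sq.smul (2⁻¹ : ℝ)).sub
    (locallyIntegrable_comp_mul_weakDeriv hu huc hs)).add hP.locallyIntegrable

theorem lintegral_weakDeriv_sq_add_eq (hu : MemH1Loc u) (huc : Continuous u) (hs : Continuous s)
    (hP : Continuous P) (ha : Tendsto u atBot (𝓝 a)) (hb : Tendsto u atTop (𝓝 b))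
    (hsP : ∀ x, s (u x) ^ 2 / 2 ≤ P x) (hab : 0 < ∫ y in a..b, s y) :
    ∫⁻ x, ENNReal.ofReal (weakDeriv u x ^ 2 / 2 + P x)
      = ENNReal.ofReal (∫ y in a..b, s y) + ∫⁻ x, ENNReal.ofReal (excess s P u x) := by
  have hdensity x : weakDeriv u x ^ 2 / 2 + P x
      = s (u x) * weakDeriv u x + excess s P u x := by
    simp only [excess]
    ring
  have hnonneg x : 0 ≤ s (u x) * weakDeriv u x + excess s P u x := by
    rw [← hdensity]
    linarith [hsP x, sq_nonneg (weakDeriv u x), sq_nonneg (s (u x))]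
  simp only [hdensity]
  exact lintegral_ofReal_add_eq_of_tendsto_integral (locallyIntegrable_comp_mul_weakDeriv hu huc hs)
    (locallyIntegrable_excess hu huc hs hP) (fun x => excess_nonneg (hsP x)) hnonneg hab
    (tendsto_integral_comp_mul_weakDeriv hu huc hs ha hb)

theorem ofReal_integral_le_lintegral_weakDeriv_sq_add (hu : MemH1Loc u) (huc : Continuous u)
    (hs : Continuous s) (hP : Continuous P) (ha : Tendsto u atBot (𝓝 a))
    (hb : Tendsto u atTop (𝓝 b)) (hsP : ∀ x, s (u x) ^ 2 / 2 ≤ P x)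
    (hab : 0 < ∫ y in a..b, s y) :
    ENNReal.ofReal (∫ y in a..b, s y) ≤ ∫⁻ x, ENNReal.ofReal (weakDeriv u x ^ 2 / 2 + P x) := by
  rw [lintegral_weakDeriv_sq_add_eq hu huc hs hP ha hb hsP hab]
  exact le_self_add

theorem ae_weakDeriv_eq_comp_iff (hu : MemH1Loc u) (huc : Continuous u) (hs : Continuous s) :
    (∀ᵐ x, weakDeriv u x = s (u x)) ↔ ∀ x, HasDerivAt u (s (u x)) x := by
  refine ⟨fun h x => ?_, weakDeriv_ae_eq_of_hasDerivAt (hs.comp huc)⟩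
  have hprim : u = fun y => u 0 + ∫ t in (0 : ℝ)..y, s (u t) := by
    ext y
    rw [← intervalIntegral.integral_congr_ae (h.mono fun t ht _ => ht), ← hu.sub_eq_integral huc]
    ring
  have hderiv := ((hs.comp huc).integral_hasStrictDerivAt 0 x).hasDerivAt.const_add (u 0)
  rwa [Function.comp_def, ← hprim] at hderiv

theorem lintegral_weakDeriv_sq_add_eq_iff (hu : MemH1Loc u) (huc : Continuous u)
    (hs : Continuous s) (hP : Continuous P) (ha : Tendsto u atBot (𝓝 a))
    (hb : Tendsto u atTop (𝓝 b)) (hsP : ∀ x, s (u x) ^ 2 / 2 ≤ P x)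
    (hab : 0 < ∫ y in a..b, s y) :
    ∫⁻ x, ENNReal.ofReal (weakDeriv u x ^ 2 / 2 + P x) = ENNReal.ofReal (∫ y in a..b, s y) ↔
      (∀ x, HasDerivAt u (s (u x)) x) ∧ ∀ x, P x = s (u x) ^ 2 / 2 := by
  have hmeas := (locallyIntegrable_excess hu huc hs hP).aestronglyMeasurable.aemeasurable
  have hcancel (e : ℝ≥0∞) :
      ENNReal.ofReal (∫ y in a..b, s y) + e = ENNReal.ofReal (∫ y in a..b, s y) ↔ e = 0 := by
    simpa only [add_zero] using ENNReal.add_right_inj (c := 0) ENNReal.ofReal_ne_top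
  have hexcess x : ENNReal.ofReal (excess s P u x) = 0 ↔
      weakDeriv u x = s (u x) ∧ P x = s (u x) ^ 2 / 2 := by
    rw [ENNReal.ofReal_eq_zero, (excess_nonneg (hsP x)).ge_iff_eq', excess_eq_zero_iff (hsP x)]
  have hPae : (∀ᵐ x, P x = s (u x) ^ 2 / 2) ↔ ∀ x, P x = s (u x) ^ 2 / 2 :=
    (hP.ae_eq_iff_eq volume (((hs.comp huc).pow 2).div_const 2)).trans funext_iff
  rw [lintegral_weakDeriv_sq_add_eq hu huc hs hP ha hb hsP hab, hcancel,
    lintegral_eq_zero_iff' hmeas.ennreal_ofReal, ← ae_weakDeriv_eq_comp_iff hu huc hs, ← hPae,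
    ← eventually_and]
  exact eventually_congr (.of_forall hexcess)

end CompletingTheSquare

section Gluing

theorem lipschitzOnWith_Icc_of_Icc_of_Icc {X : Type*} [PseudoMetricSpace X] {f : ℝ → X} {K : ℝ≥0}
    {a b c : ℝ} (hab : LipschitzOnWith K f (Set.Icc a b))
    (hbc : LipschitzOnWith K f (Set.Icc b c)) : LipschitzOnWith K f (Set.Icc a c) := by
  refine LipschitzOnWith.of_dist_le_mul fun x hx y hy => ?_
  wlog hxy : x ≤ y generalizing x y
  · rw [dist_comm, dist_comm x]
    exact this y hy x hx (le_of_not_ge hxy)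
  rcases le_total y b with hyb | hby
  · exact hab.dist_le_mul x ⟨hx.1, hxy.trans hyb⟩ y ⟨hy.1, hyb⟩
  rcases le_total b x with hbx | hxb
  · exact hbc.dist_le_mul x ⟨hbx, hx.2⟩ y ⟨hby, hy.2⟩
  · calc dist (f x) (f y) ≤ dist (f x) (f b) + dist (f b) (f y) := dist_triangle _ _ _
      _ ≤ K * dist x b + K * dist b y := add_le_add
          (hab.dist_le_mul x ⟨hx.1, hxb⟩ b ⟨hx.1.trans hxb, le_rfl⟩)
          (hbc.dist_le_mul b ⟨le_rfl, hby.trans hy.2⟩ y ⟨hby, hy.2⟩)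
      _ = K * dist x y := by
          simp only [Real.dist_eq, abs_of_nonpos (sub_nonpos.2 hxb),
            abs_of_nonpos (sub_nonpos.2 hby), abs_of_nonpos (sub_nonpos.2 hxy)]
          ring

variable {E : Type*} [NormedAddCommGroup E] [NormedSpace ℝ E]

theorem hasDerivAt_ite_le {f g f' g' : ℝ → E} {z : ℝ} (hf : ∀ x ≤ z, HasDerivAt f (f' x) x)
    (hg : ∀ x, z ≤ x → HasDerivAt g (g' x) x) (h : f z = g z) (h' : f' z = g' z) (x : ℝ) :
    HasDerivAt (fun x => if x ≤ z then f x else g x) (if x ≤ z then f' x else g' x) x := by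
  rcases lt_trichotomy x z with hx | rfl | hx
  · rw [if_pos hx.le]
    refine (hf x hx.le).congr_of_eventuallyEq ?_
    filter_upwards [Iio_mem_nhds hx] with y hy using if_pos (le_of_lt hy)
  · rw [if_pos le_rfl, ← hasDerivWithinAt_univ, ← Set.Iic_union_Ici (a := x)]
    refine HasDerivWithinAt.union ?_ ?_
    · exact (hf x le_rfl).hasDerivWithinAt.congr (fun y hy => if_pos hy) (if_pos le_rfl)
    · rw [h']
      refine (hg x le_rfl).hasDerivWithinAt.congr (fun y hy => ?_) ((if_pos le_rfl).trans h)
      rcases (Set.mem_Ici.1 hy).eq_or_lt with rfl | hxy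
      · rw [if_pos le_rfl, h]
      · exact if_neg hxy.not_ge
  · rw [if_neg hx.not_ge]
    refine (hg x hx.le).congr_of_eventuallyEq ?_
    filter_upwards [Ioi_mem_nhds hx] with y hy using if_neg (not_le_of_gt hy)

theorem hasDerivAt_max_zero_sq (x : ℝ) : HasDerivAt (fun x => max x 0 ^ 2) (2 * max x 0) x := by
  have hmax (x : ℝ) : max x 0 = if x ≤ 0 then 0 else x := by
    split_ifs with hx
    exacts [max_eq_right hx, max_eq_left (not_le.1 hx).le]
  have hpos (x : ℝ) : HasDerivAt (fun x : ℝ => x ^ 2) (2 * x) x := by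
    simpa using hasDerivAt_pow 2 x
  have hglue := hasDerivAt_ite_le (f := fun _ => 0) (f' := fun _ => 0)
    (fun x _ => hasDerivAt_const x 0) (fun x (_ : (0 : ℝ) ≤ x) => hpos x) (by simp) (by simp) x
  simpa only [hmax, ite_pow, mul_ite, mul_zero, zero_pow two_ne_zero] using hglue

end Gluing

section Potential

variable {μ y u v : ℝ}

/-- The potential part of the energy density at the values `u`, `v` of the two components. -/
def potential (μ u v : ℝ) : ℝ := (u ^ 2 + v ^ 2 - 1) ^ 2 / 4 + (μ - 1) / 2 * (u ^ 2 * v ^ 2)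

/-- The value of `v ^ 2` which minimizes `potential μ y v`. -/
def equilibriumSq (μ y : ℝ) : ℝ := max (1 - μ * y ^ 2) 0

/-- The optimal speed `√(2 min_v (potential μ y v))` of the first component at the value `y`. -/
def speed (μ y : ℝ) : ℝ := √(((1 - y ^ 2) ^ 2 - equilibriumSq μ y ^ 2) / 2)

/-- The energy of an optimal transition from `u = 0` to `u = 1`. -/
def cost (μ : ℝ) : ℝ := ∫ y in (0 : ℝ)..1, speed μ y

theorem continuous_equilibriumSq (μ : ℝ) : Continuous (equilibriumSq μ) := by
  unfold equilibriumSq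
  fun_prop

theorem continuous_speed (μ : ℝ) : Continuous (speed μ) := by
  have := continuous_equilibriumSq μ
  unfold speed
  fun_prop

theorem speed_nonneg (μ y : ℝ) : 0 ≤ speed μ y := Real.sqrt_nonneg _

theorem equilibriumSq_nonneg (μ y : ℝ) : 0 ≤ equilibriumSq μ y := le_max_right _ _

theorem le_equilibriumSq (μ y : ℝ) : 1 - μ * y ^ 2 ≤ equilibriumSq μ y := le_max_left _ _

theorem equilibriumSq_mul_sub (μ y : ℝ) :
    equilibriumSq μ y * (equilibriumSq μ y - (1 - μ * y ^ 2)) = 0 := by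
  rcases max_choice (1 - μ * y ^ 2) 0 with h | h <;> rw [equilibriumSq, h] <;> ring

theorem equilibriumSq_of_mul_sq_le_one (h : μ * y ^ 2 ≤ 1) :
    equilibriumSq μ y = 1 - μ * y ^ 2 := max_eq_left (sub_nonneg.2 h)

theorem equilibriumSq_of_one_le_mul_sq (h : 1 ≤ μ * y ^ 2) : equilibriumSq μ y = 0 :=
  max_eq_right (sub_nonpos.2 h)

theorem equilibriumSq_le_abs (hμ : 1 ≤ μ) (y : ℝ) : equilibriumSq μ y ≤ |1 - y ^ 2| :=
  max_le ((le_abs_self _).trans' (by nlinarith [sq_nonneg y])) (abs_nonneg _)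

theorem speed_sq (hμ : 1 ≤ μ) (y : ℝ) :
    speed μ y ^ 2 = ((1 - y ^ 2) ^ 2 - equilibriumSq μ y ^ 2) / 2 := by
  refine Real.sq_sqrt (div_nonneg (sub_nonneg.2 ?_) zero_le_two)
  rw [← sq_abs (1 - y ^ 2)]
  exact pow_le_pow_left₀ (equilibriumSq_nonneg μ y) (equilibriumSq_le_abs hμ y) 2

theorem potential_eq (hμ : 1 ≤ μ) (u v : ℝ) :
    potential μ u v = speed μ u ^ 2 / 2 + ((v ^ 2 - equilibriumSq μ u) ^ 2 / 4
      + v ^ 2 * (equilibriumSq μ u - (1 - μ * u ^ 2)) / 2) := by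
  rw [speed_sq hμ, potential]
  ring

theorem speed_sq_le_potential (hμ : 1 ≤ μ) (u v : ℝ) : speed μ u ^ 2 / 2 ≤ potential μ u v := by
  rw [potential_eq hμ]
  have := sub_nonneg.2 (le_equilibriumSq μ u)
  exact le_add_of_nonneg_right (by positivity)

theorem potential_eq_speed_sq_iff (hμ : 1 ≤ μ) :
    potential μ u v = speed μ u ^ 2 / 2 ↔ v ^ 2 = equilibriumSq μ u := by
  have hgap := mul_nonneg (sq_nonneg v) (sub_nonneg.2 (le_equilibriumSq μ u))
  rw [potential_eq hμ, add_eq_left]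
  refine ⟨fun h => ?_, fun h => ?_⟩
  · exact sub_eq_zero.1 (pow_eq_zero_iff two_ne_zero |>.1 (by nlinarith))
  · rw [h, equilibriumSq_mul_sub]
    ring

theorem equilibriumSq_lt (hμ : 1 < μ) (hy : y ∈ Set.Ioo (0 : ℝ) 1) :
    equilibriumSq μ y < 1 - y ^ 2 :=
  max_lt (by nlinarith [pow_pos hy.1 2]) (by nlinarith [hy.1, hy.2])

theorem speed_pos (hμ : 1 < μ) (hy : y ∈ Set.Ioo (0 : ℝ) 1) : 0 < speed μ y :=
  Real.sqrt_pos.2 <| half_pos <| sub_pos.2 <|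
    pow_lt_pow_left₀ (equilibriumSq_lt hμ hy) (equilibriumSq_nonneg μ y) two_ne_zero

theorem speed_le_one (hy : y ∈ Set.Icc (0 : ℝ) 1) : speed μ y ≤ 1 := by
  have hsq : (1 - y ^ 2) ^ 2 ≤ 1 := by
    refine pow_le_one₀ ?_ ?_ <;> nlinarith [hy.1, hy.2]
  refine Real.sqrt_le_one.2 ?_
  linarith [sq_nonneg (equilibriumSq μ y)]

theorem cost_pos (hμ : 1 < μ) : 0 < cost μ :=
  intervalIntegral.intervalIntegral_pos_of_pos_on ((continuous_speed μ).intervalIntegrable 0 1)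
    (fun _ hy => speed_pos hμ hy) zero_lt_one

theorem hasDerivAt_equilibriumSq_sq (μ y : ℝ) :
    HasDerivAt (fun y => equilibriumSq μ y ^ 2) (-(4 * μ * y * equilibriumSq μ y)) y := by
  have hinner : HasDerivAt (fun y => 1 - μ * y ^ 2) (-(μ * (2 * y))) y := by
    simpa using ((hasDerivAt_pow 2 y).const_mul μ).const_sub 1
  refine ((hasDerivAt_max_zero_sq _).comp y hinner).congr_deriv ?_
  rw [equilibriumSq]
  ring

theorem hasDerivAt_speed (hμ : 1 < μ) (hy : y ∈ Set.Ioo (0 : ℝ) 1) :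
    HasDerivAt (speed μ) (-(y * (1 - y ^ 2 - μ * equilibriumSq μ y)) / speed μ y) y := by
  have hspeed := speed_pos hμ hy
  have hsq : HasDerivAt (fun y : ℝ => (1 - y ^ 2) ^ 2) (2 * (1 - y ^ 2) * -(2 * y)) y := by
    simpa using ((hasDerivAt_pow 2 y).const_sub 1).fun_pow 2
  refine (((hsq.sub (hasDerivAt_equilibriumSq_sq μ y)).div_const 2).sqrt
    (Real.sqrt_pos.1 hspeed).ne').congr_deriv ?_
  change _ / (2 * speed μ y) = _
  field_simp
  ring

theorem speed_of_mul_sq_le_one (hμ : 1 ≤ μ) (hy : 0 ≤ y) (h : μ * y ^ 2 ≤ 1) :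
    speed μ y = √(μ - 1) * y * √(1 - (μ + 1) / 2 * y ^ 2) := by
  have hfactor : ((1 - y ^ 2) ^ 2 - (1 - μ * y ^ 2) ^ 2) / 2
      = (μ - 1) * y ^ 2 * (1 - (μ + 1) / 2 * y ^ 2) := by ring
  have hμ0 := sub_nonneg.2 hμ
  rw [speed, equilibriumSq_of_mul_sq_le_one h, hfactor, Real.sqrt_mul (by positivity),
    Real.sqrt_mul hμ0, Real.sqrt_sq hy]

theorem speed_of_one_le_mul_sq (hy : y ^ 2 ≤ 1) (h : 1 ≤ μ * y ^ 2) :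
    speed μ y = (1 - y ^ 2) / √2 := by
  rw [speed, equilibriumSq_of_one_le_mul_sq h, zero_pow two_ne_zero, sub_zero,
    Real.sqrt_div (sq_nonneg _), Real.sqrt_sq (sub_nonneg.2 hy)]

theorem mul_inv_sqrt_sq (hμ : 0 < μ) : μ * (√μ)⁻¹ ^ 2 = 1 := by
  rw [inv_pow, Real.sq_sqrt hμ.le, mul_inv_cancel₀ hμ.ne']

theorem exists_lipschitzOnWith_equilibriumSq (μ : ℝ) :
    ∃ K, LipschitzOnWith K (equilibriumSq μ) (Set.Icc 0 1) := by
  have hinner : ContDiffOn ℝ 1 (fun y : ℝ => 1 - μ * y ^ 2) (Set.Icc 0 1) := by fun_prop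
  obtain ⟨K, hK⟩ := hinner.exists_lipschitzOnWith one_ne_zero (convex_Icc 0 1) isCompact_Icc
  exact ⟨1 * K, (LipschitzWith.id.max_const 0).comp_lipschitzOnWith hK⟩

theorem exists_lipschitzOnWith_speed (hμ : 1 < μ) :
    ∃ K, LipschitzOnWith K (speed μ) (Set.Icc 0 1) := by
  have hμ0 : 0 < μ := zero_lt_one.trans hμ
  have hle : ∀ y ∈ Set.Icc 0 (√μ)⁻¹, μ * y ^ 2 ≤ 1 := fun y hy => by
    calc μ * y ^ 2 ≤ μ * (√μ)⁻¹ ^ 2 := by gcongr; exacts [hy.1, hy.2]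
      _ = 1 := mul_inv_sqrt_sq hμ0
  have hge : ∀ y ∈ Set.Icc (√μ)⁻¹ 1, 1 ≤ μ * y ^ 2 := fun y hy => by
    calc 1 = μ * (√μ)⁻¹ ^ 2 := (mul_inv_sqrt_sq hμ0).symm
      _ ≤ μ * y ^ 2 := by gcongr; exact hy.1
  have hsech : ContDiffOn ℝ 1 (speed μ) (Set.Icc 0 (√μ)⁻¹) := by
    have hroot : ∀ y ∈ Set.Icc 0 (√μ)⁻¹, 1 - (μ + 1) / 2 * y ^ 2 ≠ 0 := fun y hy => by
      nlinarith [hle y hy, sq_nonneg y]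
    refine ContDiffOn.congr ?_ fun y hy => speed_of_mul_sq_le_one hμ.le hy.1 (hle y hy)
    exact (contDiffOn_const.mul contDiffOn_id).mul (ContDiffOn.sqrt (by fun_prop) hroot)
  have htanh : ContDiffOn ℝ 1 (speed μ) (Set.Icc (√μ)⁻¹ 1) := by
    refine ContDiffOn.congr (by fun_prop) fun y hy => speed_of_one_le_mul_sq ?_ (hge y hy)
    exact pow_le_one₀ (hy.1.trans' (by positivity)) hy.2
  obtain ⟨K₁, hK₁⟩ := hsech.exists_lipschitzOnWith one_ne_zero (convex_Icc _ _) isCompact_Icc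
  obtain ⟨K₂, hK₂⟩ := htanh.exists_lipschitzOnWith one_ne_zero (convex_Icc _ _) isCompact_Icc
  exact ⟨max K₁ K₂, lipschitzOnWith_Icc_of_Icc_of_Icc (hK₁.weaken (le_max_left _ _))
    (hK₂.weaken (le_max_right _ _))⟩

end Potential

section SquareRoot

theorem dist_sqrt_le_sqrt_dist (a b : ℝ) : dist √a √b ≤ √(dist a b) := by
  wlog hab : a ≤ b generalizing a b
  · rw [dist_comm, dist_comm a]
    exact this b a (le_of_not_ge hab)
  rw [dist_comm, dist_comm a, Real.dist_eq, Real.dist_eq, abs_of_nonneg (sub_nonneg.2 hab),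
    abs_of_nonneg (sub_nonneg.2 (Real.sqrt_le_sqrt hab)), sub_le_iff_le_add']
  have ha : a ≤ √a ^ 2 := Real.sqrt_le_iff.1 le_rfl |>.2
  have hba : √(b - a) ^ 2 = b - a := Real.sq_sqrt (sub_nonneg.2 hab)
  refine Real.sqrt_le_iff.2 ⟨by positivity, ?_⟩
  nlinarith [mul_nonneg (Real.sqrt_nonneg a) (Real.sqrt_nonneg (b - a))]

theorem holderWith_sqrt : HolderWith 1 (1 / 2) Real.sqrt := fun a b => by
  rw [ENNReal.coe_one, one_mul, edist_dist, edist_dist,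
    ENNReal.ofReal_rpow_of_nonneg dist_nonneg (1 / 2 : ℝ≥0).coe_nonneg]
  refine ENNReal.ofReal_le_ofReal ((dist_sqrt_le_sqrt_dist a b).trans_eq ?_)
  rw [Real.sqrt_eq_rpow]
  norm_num

end SquareRoot

section FirstOrderSystem

variable {μ : ℝ} {u v u₁ v₁ : ℝ → ℝ}

/-- The first-order system satisfied by the transitions of least energy: `u` moves at the optimal
speed, and `v` minimizes the potential for the given `u`. -/
structure IsFirstOrderSolution (μ : ℝ) (u v : ℝ → ℝ) : Prop where
  hasDerivAt_u : ∀ x, HasDerivAt u (speed μ (u x)) x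
  sq_v : ∀ x, v x ^ 2 = equilibriumSq μ (u x)

/-- An optimal profile: an admissible pair which solves the first-order system. -/
structure IsOptimalProfile (μ : ℝ) (u v : ℝ → ℝ) : Prop
    extends Admissible u v, IsFirstOrderSolution μ u v

theorem energy_eq_lintegral_potential (μ : ℝ) (u v : ℝ → ℝ) :
    energy μ u v
      = ∫⁻ x, ENNReal.ofReal (weakDeriv u x ^ 2 / 2 + potential μ (u x) (v x)) := by
  simp only [energy, potential, add_assoc]

theorem Admissible.continuous_potential (h : Admissible u v) (μ : ℝ) :
    Continuous fun x => potential μ (u x) (v x) := by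
  have hu := h.continuous_u
  have hv := h.continuous_v
  unfold potential
  fun_prop

theorem Admissible.cost_le_energy (h : Admissible u v) (hμ : 1 < μ) :
    ENNReal.ofReal (cost μ) ≤ energy μ u v := by
  rw [energy_eq_lintegral_potential]
  exact ofReal_integral_le_lintegral_weakDeriv_sq_add h.memH1Loc_u h.continuous_u
    (continuous_speed μ) (h.continuous_potential μ) h.u_atBot h.u_atTop
    (fun x => speed_sq_le_potential hμ.le (u x) (v x)) (cost_pos hμ)

theorem Admissible.energy_eq_cost_iff (h : Admissible u v) (hμ : 1 < μ) :
    energy μ u v = ENNReal.ofReal (cost μ) ↔ IsFirstOrderSolution μ u v := by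
  have hiff := lintegral_weakDeriv_sq_add_eq_iff h.memH1Loc_u h.continuous_u
    (continuous_speed μ) (h.continuous_potential μ) h.u_atBot h.u_atTop
    (fun x => speed_sq_le_potential hμ.le (u x) (v x)) (cost_pos hμ)
  simp only [potential_eq_speed_sq_iff hμ.le] at hiff
  rw [energy_eq_lintegral_potential]
  exact hiff.trans ⟨fun ⟨hu, hv⟩ => ⟨hu, hv⟩, fun ⟨hu, hv⟩ => ⟨hu, hv⟩⟩

namespace IsFirstOrderSolution

theorem continuous_u (h : IsFirstOrderSolution μ u v) : Continuous u :=
  continuous_iff_continuousAt.2 fun x => (h.hasDerivAt_u x).continuousAt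

theorem deriv_u (h : IsFirstOrderSolution μ u v) : deriv u = fun x => speed μ (u x) :=
  funext fun x => (h.hasDerivAt_u x).deriv

theorem monotone_u (h : IsFirstOrderSolution μ u v) : Monotone u :=
  monotone_of_deriv_nonneg (fun x => (h.hasDerivAt_u x).differentiableAt) fun x => by
    rw [h.deriv_u]
    exact speed_nonneg μ (u x)

theorem memH1Loc_u (h : IsFirstOrderSolution μ u v) : MemH1Loc u :=
  memH1Loc_of_hasDerivAt ((continuous_speed μ).comp h.continuous_u) h.hasDerivAt_u

theorem lipschitzWith_u (h : IsFirstOrderSolution μ u v) (hu : ∀ x, u x ∈ Set.Icc 0 1) :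
    LipschitzWith 1 u := by
  refine lipschitzWith_of_nnnorm_deriv_le (𝕜 := ℝ)
    (fun x => (h.hasDerivAt_u x).differentiableAt) fun x => ?_
  rw [h.deriv_u, ← NNReal.coe_le_coe, coe_nnnorm, Real.norm_of_nonneg (speed_nonneg μ (u x))]
  exact speed_le_one (hu x)

theorem v_eq_sqrt (h : IsFirstOrderSolution μ u v) (hv : ∀ x, 0 ≤ v x) :
    v = fun x => √(equilibriumSq μ (u x)) :=
  funext fun x => by rw [← h.sq_v, Real.sqrt_sq (hv x)]

theorem exists_holderWith_v (h : IsFirstOrderSolution μ u v) (hu : ∀ x, u x ∈ Set.Icc 0 1)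
    (hv : ∀ x, 0 ≤ v x) : ∃ C, HolderWith C (1 / 2) v := by
  obtain ⟨K, hK⟩ := exists_lipschitzOnWith_equilibriumSq μ
  have hlip : LipschitzWith (K * 1) (equilibriumSq μ ∘ u) := by
    rw [← lipschitzOnWith_univ]
    exact hK.comp (h.lipschitzWith_u hu).lipschitzOnWith fun x _ => hu x
  rw [h.v_eq_sqrt hv]
  exact ⟨_, by simpa only [mul_one, Function.comp_def] using
    holderWith_sqrt.comp (holderWith_one.2 hlip)⟩

theorem hasDerivAt_deriv_u (h : IsFirstOrderSolution μ u v) (hμ : 1 < μ) {x : ℝ}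
    (hx : u x ∈ Set.Ioo 0 1) :
    HasDerivAt (deriv u) (-(u x * (1 - u x ^ 2 - μ * v x ^ 2))) x := by
  rw [h.deriv_u, h.sq_v]
  refine ((hasDerivAt_speed hμ hx).comp x (h.hasDerivAt_u x)).congr_deriv ?_
  exact div_mul_cancel₀ _ (speed_pos hμ hx).ne'

theorem isSolution (h : IsFirstOrderSolution μ u v) (hμ : 1 < μ) (hu : ∀ x, u x ∈ Set.Ioo 0 1)
    (hv : Continuous v) : IsSolution μ u v where
  contDiff_u := by
    have hucont := h.continuous_u
    have hderiv x := h.hasDerivAt_deriv_u hμ (hu x)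
    rw [← one_add_one_eq_two, contDiff_succ_iff_deriv]
    refine ⟨fun x => (h.hasDerivAt_u x).differentiableAt, by simp, ?_⟩
    rw [contDiff_one_iff_deriv]
    refine ⟨fun x => (hderiv x).differentiableAt, ?_⟩
    rw [funext fun x => (hderiv x).deriv]
    fun_prop
  continuous_v := hv
  eq_u x := by
    rw [(h.hasDerivAt_deriv_u hμ (hu x)).deriv]
    ring
  eq_v x := by
    have hsq : v x ^ 2 * (v x ^ 2 - (1 - μ * u x ^ 2)) = 0 := by
      rw [h.sq_v, equilibriumSq_mul_sub]
    rcases mul_eq_zero.1 hsq with hv0 | hv1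
    · rw [pow_eq_zero_iff two_ne_zero |>.1 hv0, zero_mul]
    · rw [mul_eq_zero]
      right
      linarith

theorem comp_sub_const (h : IsFirstOrderSolution μ u v) (c : ℝ) :
    IsFirstOrderSolution μ (fun x => u (x - c)) (fun x => v (x - c)) where
  hasDerivAt_u x := (h.hasDerivAt_u (x - c)).comp_sub_const x c
  sq_v x := h.sq_v (x - c)

end IsFirstOrderSolution

namespace IsOptimalProfile

theorem u_mem_Icc (h : IsOptimalProfile μ u v) (x : ℝ) : u x ∈ Set.Icc 0 1 :=
  ⟨h.monotone_u.le_of_tendsto h.u_atBot x, h.monotone_u.ge_of_tendsto h.u_atTop x⟩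

theorem isPreconnected_setOf_v_ne_zero (h : IsOptimalProfile μ u v) (hμ : 0 ≤ μ) :
    IsPreconnected {x | v x ≠ 0} := by
  have hset : {x | v x ≠ 0} = {x | μ * u x ^ 2 < 1} := by
    ext x
    rw [Set.mem_ofPred_eq, Set.mem_ofPred_eq, ← pow_ne_zero_iff two_ne_zero, h.sq_v, equilibriumSq,
      ne_eq, max_eq_right_iff, sub_nonpos, not_le]
  rw [hset]
  have hlower : IsLowerSet {x | μ * u x ^ 2 < 1} := fun x y hyx hx => by
    refine lt_of_le_of_lt ?_ (Set.mem_ofPred.1 hx)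
    gcongr
    exacts [(h.u_mem_Icc y).1, h.monotone_u hyx]
  exact hlower.ordConnected.isPreconnected

theorem v_nonneg (h : IsOptimalProfile μ u v) (hμ : 0 ≤ μ) (x : ℝ) : 0 ≤ v x := by
  by_contra! hx
  obtain ⟨y, hy⟩ := (h.v_atBot.eventually (lt_mem_nhds one_pos)).exists
  obtain ⟨t, ht, ht0⟩ := (h.isPreconnected_setOf_v_ne_zero hμ).intermediate_value
    (Set.mem_ofPred.2 hx.ne) (Set.mem_ofPred.2 hy.ne') h.continuous_v.continuousOn ⟨hx.le, hy.le⟩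
  exact ht ht0

theorem comp_sub_const (h : IsOptimalProfile μ u v) (c : ℝ) :
    IsOptimalProfile μ (fun x => u (x - c)) (fun x => v (x - c)) := by
  have hfirst := h.toIsFirstOrderSolution.comp_sub_const c
  have hbot : Tendsto (fun x => x - c) atBot atBot := tendsto_atBot_add_const_right _ _ tendsto_id
  have htop : Tendsto (fun x => x - c) atTop atTop := tendsto_atTop_add_const_right _ _ tendsto_id
  exact ⟨⟨hfirst.memH1Loc_u, hfirst.continuous_u, h.continuous_v.comp (by fun_prop),
    h.u_atBot.comp hbot, h.v_atBot.comp hbot, h.u_atTop.comp htop, h.v_atTop.comp htop⟩, hfirst⟩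

theorem exists_u_eq (h : IsOptimalProfile μ u v) {y : ℝ} (hy : y ∈ Set.Ioo 0 1) :
    ∃ x, u x = y :=
  mem_range_of_exists_le_of_exists_ge h.toAdmissible.continuous_u
    ((h.u_atBot.eventually (gt_mem_nhds hy.1)).exists.imp fun _ => le_of_lt)
    ((h.u_atTop.eventually (lt_mem_nhds hy.2)).exists.imp fun _ => le_of_lt)

theorem eq_of_u_eq (h : IsOptimalProfile μ u v) (h₁ : IsOptimalProfile μ u₁ v₁) (hμ : 1 < μ)
    {t : ℝ} (ht : u t = u₁ t) : u = u₁ ∧ v = v₁ := by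
  obtain ⟨K, hK⟩ := exists_lipschitzOnWith_speed hμ
  have hu : u = u₁ := ODE_solution_unique_univ (fun _ => hK)
    (fun x => ⟨h.hasDerivAt_u x, h.u_mem_Icc x⟩) (fun x => ⟨h₁.hasDerivAt_u x, h₁.u_mem_Icc x⟩) ht
  have hμ0 := zero_le_one.trans hμ.le
  refine ⟨hu, ?_⟩
  rw [h.v_eq_sqrt (h.v_nonneg hμ0), h₁.v_eq_sqrt (h₁.v_nonneg hμ0), hu]

theorem exists_eq_translate (h : IsOptimalProfile μ u v) (h₁ : IsOptimalProfile μ u₁ v₁)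
    (hμ : 1 < μ) : ∃ c, (∀ x, u x = u₁ (x - c)) ∧ ∀ x, v x = v₁ (x - c) := by
  have hhalf : (1 / 2 : ℝ) ∈ Set.Ioo 0 1 := by norm_num
  obtain ⟨t, ht⟩ := h.exists_u_eq hhalf
  obtain ⟨t₁, ht₁⟩ := h₁.exists_u_eq hhalf
  obtain ⟨hu, hv⟩ := h.eq_of_u_eq (t := t) (h₁.comp_sub_const (t - t₁)) hμ
    (by rw [sub_sub_cancel, ht, ht₁])
  exact ⟨t - t₁, congrFun hu, congrFun hv⟩

theorem energy_eq_cost (h : IsOptimalProfile μ u v) (hμ : 1 < μ) :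
    energy μ u v = ENNReal.ofReal (cost μ) :=
  (h.energy_eq_cost_iff hμ).2 h.toIsFirstOrderSolution

theorem energy_lt_top (h : IsOptimalProfile μ u v) (hμ : 1 < μ) : energy μ u v < ⊤ :=
  (h.energy_eq_cost hμ).trans_lt ENNReal.ofReal_lt_top

theorem isMinimizer (h : IsOptimalProfile μ u v) (hμ : 1 < μ) : IsMinimizer μ u v :=
  ⟨h.toAdmissible, fun _ _ h₁ => (h.energy_eq_cost hμ).trans_le (h₁.cost_le_energy hμ)⟩

theorem of_isMinimizer (h₁ : IsOptimalProfile μ u₁ v₁) (hμ : 1 < μ) (h : IsMinimizer μ u v) :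
    IsOptimalProfile μ u v :=
  ⟨h.1, (h.1.energy_eq_cost_iff hμ).1 <|
    ((h.2 _ _ h₁.toAdmissible).trans_eq (h₁.energy_eq_cost hμ)).antisymm (h.1.cost_le_energy hμ)⟩

theorem isMinimizer_iff_exists_translate (h₁ : IsOptimalProfile μ u₁ v₁) (hμ : 1 < μ) :
    IsMinimizer μ u v ↔ ∃ c, (∀ x, u x = u₁ (x - c)) ∧ ∀ x, v x = v₁ (x - c) := by
  refine ⟨fun h => (h₁.of_isMinimizer hμ h).exists_eq_translate h₁ hμ, ?_⟩
  rintro ⟨c, hu, hv⟩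
  rw [funext hu, funext hv]
  exact (h₁.comp_sub_const c).isMinimizer hμ

end IsOptimalProfile

end FirstOrderSystem

section Hyperbolic

theorem hasDerivAt_tanh (x : ℝ) : HasDerivAt Real.tanh (1 - Real.tanh x ^ 2) x := by
  have hcosh := (Real.cosh_pos x).ne'
  rw [funext Real.tanh_eq_sinh_div_cosh]
  refine ((Real.hasDerivAt_sinh x).div (Real.hasDerivAt_cosh x) hcosh).congr_deriv ?_
  field_simp

theorem strictMono_tanh : StrictMono Real.tanh := strictMono_of_deriv_pos fun x => by
  rw [(hasDerivAt_tanh x).deriv]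
  exact sub_pos.2 (Real.tanh_sq_lt_one x)

theorem tendsto_tanh_atTop : Tendsto Real.tanh atTop (𝓝 1) := by
  refine tendsto_atTop_isLUB strictMono_tanh.monotone ?_
  rw [← Set.image_univ, Real.tanh_bijOn.image_eq]
  exact isLUB_Ioo (by norm_num)

theorem sech_pos (x : ℝ) : 0 < sech x := one_div_pos.2 (Real.cosh_pos x)

theorem monotoneOn_sech : MonotoneOn sech (Set.Iic 0) := fun x hx y hy hxy =>
  one_div_le_one_div_of_le (Real.cosh_pos y) <| Real.cosh_le_cosh.2 <| by
    rw [abs_of_nonpos (Set.mem_Iic.1 hx), abs_of_nonpos (Set.mem_Iic.1 hy)]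
    exact neg_le_neg hxy

theorem tendsto_sech_atBot : Tendsto sech atBot (𝓝 0) := by
  have hexp : Tendsto (fun x : ℝ => 2 * Real.exp x) atBot (𝓝 0) := by
    simpa using Real.tendsto_exp_atBot.const_mul 2
  refine squeeze_zero (fun x => (sech_pos x).le) (fun x => ?_) hexp
  have hmul : Real.exp x * Real.exp (-x) = 1 := by
    rw [← Real.exp_add, add_neg_cancel, Real.exp_zero]
  rw [sech, div_le_iff₀ (Real.cosh_pos x), Real.cosh_eq]
  nlinarith [Real.exp_pos x]

theorem tanh_eq_neg_sqrt {x : ℝ} (hx : x ≤ 0) : Real.tanh x = -√(1 - sech x ^ 2) := by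
  have hsq : 1 - sech x ^ 2 = Real.tanh x ^ 2 := by
    have hcosh := (Real.cosh_pos x).ne'
    rw [Real.tanh_eq_sinh_div_cosh, sech]
    field_simp
    linarith [Real.cosh_sq x]
  have hnonpos : Real.tanh x ≤ 0 := by
    rw [← Real.tanh_zero]
    exact strictMono_tanh.monotone hx
  rw [hsq, Real.sqrt_sq_eq_abs, abs_of_nonpos hnonpos, neg_neg]

theorem hasDerivAt_sech_of_nonpos {x : ℝ} (hx : x ≤ 0) :
    HasDerivAt sech (sech x * √(1 - sech x ^ 2)) x := by
  have hcosh := (Real.cosh_pos x).ne'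
  have hinv : sech = fun x => (Real.cosh x)⁻¹ := funext fun x => one_div _
  rw [← neg_eq_iff_eq_neg.2 (tanh_eq_neg_sqrt hx), Real.tanh_eq_sinh_div_cosh, hinv]
  refine ((Real.hasDerivAt_cosh x).inv hcosh).congr_deriv ?_
  field_simp

theorem sech_arcsech {y : ℝ} (hy : y ∈ Set.Ioc 0 1) : sech (arcsech y) = y := by
  rw [sech, arcsech, Real.cosh_arcosh ((one_le_div hy.1).2 hy.2), one_div_one_div]

theorem arcsech_nonneg {y : ℝ} (hy : y ∈ Set.Ioc 0 1) : 0 ≤ arcsech y :=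
  Real.arcosh_nonneg ((one_le_div hy.1).2 hy.2)

end Hyperbolic

section SechPiece

variable {μ c x z : ℝ}

/-- The solution of the first-order equation for `u` in the region `μ u² ≤ 1`, with crest at
`c`. -/
def sechPiece (μ c x : ℝ) : ℝ := √(2 / (μ + 1)) * sech (√(μ - 1) * (x - c))

theorem sechPiece_pos (hμ : 0 ≤ μ) (c x : ℝ) : 0 < sechPiece μ c x :=
  mul_pos (by positivity) (sech_pos _)

theorem sech_sq_eq_sechPiece_sq (hμ : 0 ≤ μ) (c x : ℝ) :
    sech (√(μ - 1) * (x - c)) ^ 2 = (μ + 1) / 2 * sechPiece μ c x ^ 2 := by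
  rw [sechPiece, mul_pow, Real.sq_sqrt (by positivity)]
  field_simp

theorem monotoneOn_sechPiece (μ c : ℝ) : MonotoneOn (sechPiece μ c) (Set.Iic c) := by
  have hphase {x : ℝ} (hx : x ≤ c) : √(μ - 1) * (x - c) ≤ 0 :=
    mul_nonpos_of_nonneg_of_nonpos (Real.sqrt_nonneg _) (sub_nonpos.2 hx)
  exact fun x hx y hy hxy => mul_le_mul_of_nonneg_left
    (monotoneOn_sech (hphase hx) (hphase hy) (by gcongr)) (Real.sqrt_nonneg _)

theorem tendsto_sechPiece_atBot (hμ : 1 < μ) (c : ℝ) : Tendsto (sechPiece μ c) atBot (𝓝 0) := by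
  have hphase : Tendsto (fun x => √(μ - 1) * (x - c)) atBot atBot :=
    (tendsto_atBot_add_const_right _ (-c) tendsto_id).const_mul_atBot
      (Real.sqrt_pos.2 (sub_pos.2 hμ))
  have hlim := (tendsto_sech_atBot.comp hphase).const_mul √(2 / (μ + 1))
  rwa [mul_zero] at hlim

theorem hasDerivAt_sechPiece (hμ : 0 ≤ μ) (hx : x ≤ c) :
    HasDerivAt (sechPiece μ c)
      (√(μ - 1) * sechPiece μ c x * √(1 - (μ + 1) / 2 * sechPiece μ c x ^ 2)) x := by
  have hphase : HasDerivAt (fun x => √(μ - 1) * (x - c)) √(μ - 1) x := by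
    simpa using ((hasDerivAt_id x).sub_const c).const_mul √(μ - 1)
  have hnonpos : √(μ - 1) * (x - c) ≤ 0 :=
    mul_nonpos_of_nonneg_of_nonpos (Real.sqrt_nonneg _) (sub_nonpos.2 hx)
  rw [← sech_sq_eq_sechPiece_sq hμ]
  refine (((hasDerivAt_sech_of_nonpos hnonpos).comp x hphase).const_mul
    √(2 / (μ + 1))).congr_deriv ?_
  rw [sechPiece]
  ring

theorem sqrt_mem_Ioc (hμ : 1 ≤ μ) : √((μ + 1) / (2 * μ)) ∈ Set.Ioc 0 1 := by
  refine ⟨by positivity, Real.sqrt_le_one.2 ?_⟩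
  rw [div_le_one (by positivity)]
  linarith

theorem le_x₁ (hμ : 1 ≤ μ) (z : ℝ) : z ≤ x₁ μ z :=
  le_add_of_nonneg_right (mul_nonneg (by positivity) (arcsech_nonneg (sqrt_mem_Ioc hμ)))

theorem sechPiece_x₁_self (hμ : 1 < μ) (z : ℝ) : sechPiece μ (x₁ μ z) z = (√μ)⁻¹ := by
  have hphase : √(μ - 1) * (z - x₁ μ z) = -arcsech √((μ + 1) / (2 * μ)) := by
    have hne : √(μ - 1) ≠ 0 := (Real.sqrt_pos.2 (sub_pos.2 hμ)).ne'
    rw [x₁]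
    field_simp
    ring
  have heven (x : ℝ) : sech (-x) = sech x := by rw [sech, sech, Real.cosh_neg]
  have hmul : 2 / (μ + 1) * ((μ + 1) / (2 * μ)) = μ⁻¹ := by field_simp
  rw [sechPiece, hphase, heven, sech_arcsech (sqrt_mem_Ioc hμ.le), ← Real.sqrt_mul (by positivity),
    hmul, Real.sqrt_inv]

theorem mul_sechPiece_sq_le_one (hμ : 1 < μ) (hx : x ≤ z) :
    μ * sechPiece μ (x₁ μ z) x ^ 2 ≤ 1 := by
  have hμ0 := zero_lt_one.trans hμ
  have hz := le_x₁ hμ.le z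
  calc μ * sechPiece μ (x₁ μ z) x ^ 2 ≤ μ * sechPiece μ (x₁ μ z) z ^ 2 := by
        gcongr
        exacts [(sechPiece_pos hμ0.le _ x).le, monotoneOn_sechPiece _ _ (hx.trans hz) hz hx]
    _ = 1 := by rw [sechPiece_x₁_self hμ, mul_inv_sqrt_sq hμ0]

theorem hasDerivAt_sechPiece_speed (hμ : 1 < μ) (hx : x ≤ z) :
    HasDerivAt (sechPiece μ (x₁ μ z)) (speed μ (sechPiece μ (x₁ μ z) x)) x := by
  have hμ0 := zero_le_one.trans hμ.le
  rw [speed_of_mul_sq_le_one hμ.le (sechPiece_pos hμ0 _ x).le (mul_sechPiece_sq_le_one hμ hx)]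
  exact hasDerivAt_sechPiece hμ0 (hx.trans (le_x₁ hμ.le z))

end SechPiece

section TanhPiece

/-- The solution of the first-order equation for `u` in the region `μ u² ≥ 1`. The zero `c` of
the formula lies outside that region. -/
def tanhPiece (c x : ℝ) : ℝ := Real.tanh ((x - c) / √2)

theorem strictMono_tanhPiece (c : ℝ) : StrictMono (tanhPiece c) := fun _ _ hxy =>
  strictMono_tanh (by gcongr)

theorem tendsto_tanhPiece_atTop (c : ℝ) : Tendsto (tanhPiece c) atTop (𝓝 1) := by
  have hphase : Tendsto (fun x : ℝ => (x - c) / √2) atTop atTop :=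
    (tendsto_atTop_add_const_right _ (-c) tendsto_id).atTop_div_const (by positivity)
  exact tendsto_tanh_atTop.comp hphase

theorem hasDerivAt_tanhPiece (c x : ℝ) :
    HasDerivAt (tanhPiece c) ((1 - tanhPiece c x ^ 2) / √2) x := by
  refine ((hasDerivAt_tanh _).comp x (((hasDerivAt_id x).sub_const c).div_const √2)).congr_deriv ?_
  rw [tanhPiece, mul_one_div]
  rfl

theorem existsUnique_tanhPiece_eq {y : ℝ} (hy : y ∈ Set.Ioo (-1) 1) (z : ℝ) :
    ∃! c, tanhPiece c z = y := by
  have hiff (c : ℝ) : tanhPiece c z = y ↔ c = z - √2 * Real.artanh y := by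
    calc tanhPiece c z = y ↔ Real.tanh ((z - c) / √2) = Real.tanh (Real.artanh y) := by
          rw [tanhPiece, Real.tanh_artanh hy]
      _ ↔ z - c = √2 * Real.artanh y := by
          rw [Real.tanh_injective.eq_iff, div_eq_iff (by positivity), mul_comm]
      _ ↔ c = z - √2 * Real.artanh y := by
          rw [sub_eq_iff_eq_add', eq_sub_iff_add_eq, eq_comm]
  exact ⟨_, (hiff _).2 rfl, fun c hc => (hiff c).1 hc⟩

end TanhPiece

section Matching

variable {μ z x₀ x : ℝ}

theorem inv_sqrt_mem_Ioo (hμ : 1 < μ) : (√μ)⁻¹ ∈ Set.Ioo 0 1 :=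
  ⟨by positivity, inv_lt_one_of_one_lt₀ (Real.lt_sqrt_of_sq_lt (by simpa using hμ))⟩

theorem isMatching_iff (hμ : 1 < μ) : IsMatching μ z x₀ ↔ tanhPiece x₀ z = (√μ)⁻¹ := by
  rw [← sechPiece_x₁_self hμ z]
  rfl

theorem existsUnique_isMatching (hμ : 1 < μ) (z : ℝ) : ∃! x₀, IsMatching μ z x₀ := by
  have hy := inv_sqrt_mem_Ioo hμ
  simp only [isMatching_iff hμ]
  exact existsUnique_tanhPiece_eq ⟨by linarith [hy.1], hy.2⟩ z

theorem u₀_of_le (hx : x ≤ z) : u₀ μ z x₀ x = sechPiece μ (x₁ μ z) x := if_pos hx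

theorem u₀_of_lt (hx : z < x) : u₀ μ z x₀ x = tanhPiece x₀ x := if_neg hx.not_ge

namespace IsMatching

theorem inv_sqrt_le_tanhPiece (h : IsMatching μ z x₀) (hμ : 1 < μ) (hx : z ≤ x) :
    (√μ)⁻¹ ≤ tanhPiece x₀ x :=
  ((isMatching_iff hμ).1 h).symm.trans_le ((strictMono_tanhPiece x₀).monotone hx)

theorem one_le_mul_tanhPiece_sq (h : IsMatching μ z x₀) (hμ : 1 < μ) (hx : z ≤ x) :
    1 ≤ μ * tanhPiece x₀ x ^ 2 := by
  have hμ0 := zero_lt_one.trans hμ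
  calc 1 = μ * (√μ)⁻¹ ^ 2 := (mul_inv_sqrt_sq hμ0).symm
    _ ≤ μ * tanhPiece x₀ x ^ 2 := by
        gcongr
        exact h.inv_sqrt_le_tanhPiece hμ hx

theorem hasDerivAt_tanhPiece_speed (h : IsMatching μ z x₀) (hμ : 1 < μ) (hx : z ≤ x) :
    HasDerivAt (tanhPiece x₀) (speed μ (tanhPiece x₀ x)) x := by
  have hle : tanhPiece x₀ x ^ 2 ≤ 1 := (Real.tanh_sq_lt_one _).le
  rw [speed_of_one_le_mul_sq hle (h.one_le_mul_tanhPiece_sq hμ hx)]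
  exact hasDerivAt_tanhPiece x₀ x

theorem u₀_mem_Ioo (h : IsMatching μ z x₀) (hμ : 1 < μ) (x : ℝ) :
    u₀ μ z x₀ x ∈ Set.Ioo 0 1 := by
  rcases le_or_gt x z with hx | hx
  · have hpos := sechPiece_pos (zero_le_one.trans hμ.le) (x₁ μ z) x
    have hle := mul_sechPiece_sq_le_one hμ hx
    rw [u₀_of_le hx]
    exact ⟨hpos, lt_of_pow_lt_pow_left₀ 2 zero_le_one (by nlinarith)⟩
  · rw [u₀_of_lt hx]
    exact ⟨(inv_sqrt_mem_Ioo hμ).1.trans_le (h.inv_sqrt_le_tanhPiece hμ hx.le), Real.tanh_lt_one _⟩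

theorem hasDerivAt_u₀ (h : IsMatching μ z x₀) (hμ : 1 < μ) (x : ℝ) :
    HasDerivAt (u₀ μ z x₀) (speed μ (u₀ μ z x₀ x)) x := by
  have hz : sechPiece μ (x₁ μ z) z = tanhPiece x₀ z := by
    rw [sechPiece_x₁_self hμ, (isMatching_iff hμ).1 h]
  have hglue := hasDerivAt_ite_le (fun x hx => hasDerivAt_sechPiece_speed hμ hx)
    (fun x hx => h.hasDerivAt_tanhPiece_speed hμ hx) hz (congrArg (speed μ) hz) x
  rwa [← apply_ite (speed μ)] at hglue

theorem v₀_eq_sqrt (h : IsMatching μ z x₀) (hμ : 1 < μ) (x : ℝ) :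
    v₀ μ z x = √(1 - μ * u₀ μ z x₀ x ^ 2) := by
  rcases le_or_gt x z with hx | hx
  · have hμ0 := zero_le_one.trans hμ.le
    rw [u₀_of_le hx, v₀, if_pos hx, sech_sq_eq_sechPiece_sq hμ0]
    congr 2
    field_simp
  · have hle := h.one_le_mul_tanhPiece_sq hμ hx.le
    rw [u₀_of_lt hx, v₀, if_neg hx.not_ge, Real.sqrt_eq_zero_of_nonpos (sub_nonpos.2 hle)]

theorem isFirstOrderSolution (h : IsMatching μ z x₀) (hμ : 1 < μ) :
    IsFirstOrderSolution μ (u₀ μ z x₀) (v₀ μ z) where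
  hasDerivAt_u := h.hasDerivAt_u₀ hμ
  sq_v x := by rw [h.v₀_eq_sqrt hμ, Real.sq_sqrt', equilibriumSq]

theorem isOptimalProfile (h : IsMatching μ z x₀) (hμ : 1 < μ) :
    IsOptimalProfile μ (u₀ μ z x₀) (v₀ μ z) := by
  have hfirst := h.isFirstOrderSolution hμ
  have hu := hfirst.continuous_u
  have hbot : Tendsto (u₀ μ z x₀) atBot (𝓝 0) :=
    (tendsto_sechPiece_atBot hμ _).congr' <|
      (eventually_le_atBot z).mono fun x hx => (u₀_of_le hx).symm
  have htop : Tendsto (u₀ μ z x₀) atTop (𝓝 1) :=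
    (tendsto_tanhPiece_atTop x₀).congr' <|
      (eventually_gt_atTop z).mono fun x hx => (u₀_of_lt hx).symm
  refine ⟨⟨hfirst.memH1Loc_u, hu, ?_, hbot, ?_, htop, ?_⟩, hfirst⟩
  · rw [funext (h.v₀_eq_sqrt hμ)]
    fun_prop
  · rw [funext (h.v₀_eq_sqrt hμ)]
    simpa using (((hbot.pow 2).const_mul μ).const_sub 1).sqrt
  · exact tendsto_const_nhds.congr' <|
      (eventually_gt_atTop z).mono fun x hx => (if_neg hx.not_ge).symm

end IsMatching

end Matching

end ThomasFermi

end

theorem mainTheorem3 (μ : ℝ) (hμ : 1 < μ) (z : ℝ) :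
    (∃! x₀ : ℝ, ThomasFermi.IsMatching μ z x₀) ∧
    ∀ x₀ : ℝ, ThomasFermi.IsMatching μ z x₀ →
      ThomasFermi.IsSolution μ (ThomasFermi.u₀ μ z x₀) (ThomasFermi.v₀ μ z) ∧
      (∃ K : ℝ≥0, LipschitzWith K (ThomasFermi.u₀ μ z x₀)) ∧
      (∃ C : ℝ≥0, HolderWith C (1 / 2) (ThomasFermi.v₀ μ z)) ∧
      ThomasFermi.energy μ (ThomasFermi.u₀ μ z x₀) (ThomasFermi.v₀ μ z) < ⊤ ∧
      ThomasFermi.IsMinimizer μ (ThomasFermi.u₀ μ z x₀) (ThomasFermi.v₀ μ z) ∧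
      ∀ u v : ℝ → ℝ, ThomasFermi.IsMinimizer μ u v ↔
        ∃ c : ℝ, (∀ x, u x = ThomasFermi.u₀ μ z x₀ (x - c)) ∧
          ∀ x, v x = ThomasFermi.v₀ μ z (x - c) := by
  refine ⟨ThomasFermi.existsUnique_isMatching hμ z, fun x₀ h => ?_⟩
  have hprofile := h.isOptimalProfile hμ
  have hsolution := hprofile.toIsFirstOrderSolution.isSolution hμ (h.u₀_mem_Ioo hμ)
    hprofile.continuous_v
  have hlipschitz := hprofile.lipschitzWith_u hprofile.u_mem_Icc
  have hholder := hprofile.exists_holderWith_v hprofile.u_mem_Icc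
    (hprofile.v_nonneg (zero_le_one.trans hμ.le))
  exact ⟨hsolution, ⟨1, hlipschitz⟩, hholder, hprofile.energy_lt_top hμ, hprofile.isMinimizer hμ,
    fun _ _ => hprofile.isMinimizer_iff_exists_translate hμ⟩
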